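/- A LOTS is a linear order with its open interval topology; $A$ LOTS-embeds (continuously embeds) into $B$ if there is an injective, order-preserving map $A\to B$ that is continuous for the open interval topologies. A LOTS basis for the uncountable linear orders is a family of uncountable linear orders such that every uncountable linear order continuously embeds some member of the family. A linear order is $\aleph_1$-dense if it has size $\aleph_1$, has no endpoints, and every interval $(a,b)$ with $a<b$ has size $\aleph_1$. A Countryman line is a linear order of size $\aleph_1$ whose square is a union of countably many chains in the product order; it is non-stationary if it is the union of a continuous increasing chain $\langle D_\delta:\delta<\omega_1\rangle$ of countable subsets such that, for every $\delta$, no maximal convex subset of the complement of $D_\delta$ has a least or a greatest element. Let $X$ be an $\aleph_1$-dense set of reals and let $C$ be an $\aleph_1$-dense non-stationary Countryman line. Consider the eleven linear orders $$X,\; X\times 2,\; X\times\omega,\; X\times\omega^*,\; X\times\mathbb Z,\; C\times\mathbb Z,\; C^*\times\mathbb Z,\; \omega_1,\; \omega_1\bar\times\omega^*,\; \omega_1^*,\; \omega_1^*\bar\times\omega,$$ where $L^*$ is the reverse of $L$, products are lexicographic (first coordinate dominant), $\omega_1\bar\times\omega^*$ is obtained from $\omega_1$ by replacing every nonzero limit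 ordinal by a copy of $\omega^*$, and $\omega_1^*\bar\times\omega$ is obtained from $\omega_1^*$ by replacing every nonzero limit ordinal by a copy of $\omega$. (Under PFA these eleven orders form a LOTS basis for the uncountable linear orders; the following does not need PFA.) Then: 1. none of the eleven orders continuously embeds into another one of them; 2. no uncountable linear order continuously embeds into two distinct ones of the eleven orders; 3. for every LOTS basis for the uncountable linear orders, each of the eleven orders continuously embeds some member of that basis; in particular, no proper subfamily of the eleven orders is a LOTS basis, and every LOTS basis for the uncountable linear orders has at least eleven elements. -/

import Mathlib

universe u v w

open Cardinal Ordinal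

namespace LOTS

/-- `A` LOTS-embeds into `B`: there is an injective order-preserving map `A → B` (between linear
orders, equivalently, a strictly increasing one) which is continuous for the open interval
topologies of `A` and `B`. -/
def Embeds (A : Type u) (B : Type v) [LinearOrder A] [LinearOrder B] : Prop :=
  ∃ f : A → B, StrictMono f ∧
    @Continuous A B (Preorder.topology A) (Preorder.topology B) f

/-- A linear order is `ℵ₁`-dense: it has size `ℵ₁`, has no end-points, and every nonempty open
interval between two of its points has size `ℵ₁`. -/
structure IsAlephOneDense (L : Type u) [LinearOrder L] : Prop where
  card_eq : #L = ℵ₁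
  noMin : NoMinOrder L
  noMax : NoMaxOrder L
  card_Ioo : ∀ a b : L, a < b → #(Set.Ioo a b) = ℵ₁

/-- `X` is (order isomorphic to) an `ℵ₁`-dense set of reals. -/
structure IsAlephOneDenseRealSet (X : Type u) [LinearOrder X] : Prop where
  real_set : ∃ S : Set ℝ, Nonempty (X ≃o S)
  dense : IsAlephOneDense X

/-- A Countryman line: a linear order of size `ℵ₁` whose square is the union of countably many
chains in the product (coordinatewise) order. -/
structure IsCountryman (C : Type u) [LinearOrder C] : Prop where
  card_eq : #C = ℵ₁
  chains : ∃ S : ℕ → Set (C × C), (∀ n, IsChain (· ≤ ·) (S n)) ∧ ⋃ n, S n = Set.univ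

/-- The ordinal `ω₁` as a linear order. -/
abbrev Omega1 : Type u := (ω₁ : Ordinal.{u}).ToType

/-- Non-stationarity of a line: it is the union of a continuous increasing chain
`⟨D δ : δ < ω₁⟩` of countable subsets such that no maximal convex subset of the complement of any
`D δ` has a least or a greatest element. -/
def IsNonstationary (A : Type u) [LinearOrder A] : Prop :=
  ∃ D : Omega1.{u} → Set A,
    (∀ δ, (D δ).Countable) ∧
    Monotone D ∧
    (∀ δ, Order.IsSuccLimit δ → D δ = ⋃ γ ∈ Set.Iio δ, D γ) ∧
    (⋃ δ, D δ = Set.univ) ∧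
    ∀ δ, ∀ K : Set A, Maximal (fun K' : Set A => K'.OrdConnected ∧ K' ⊆ (D δ)ᶜ) K →
      (¬ ∃ a, IsLeast K a) ∧ ¬ ∃ a, IsGreatest K a

/-- The lexicographic product over `α ∈ ω₁` of the orders `L α`, where `L α` is `ω*` if `α` is
a (nonzero) limit ordinal, and is a single point otherwise. -/
abbrev Omega1BarOmegaStar : Type u :=
  {p : Omega1.{u} ×ₗ ℕᵒᵈ //
    Order.IsSuccLimit (ofLex p).1 ∨ (ofLex p).2 = OrderDual.toDual 0}

/-- The lexicographic product over `α ∈ ω₁*` of the orders `L α`, where `L α` is `ω` if `α` is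
a (nonzero) limit ordinal, and is a single point otherwise. -/
abbrev Omega1StarBarOmega : Type u :=
  {p : Omega1.{u}ᵒᵈ ×ₗ ℕ //
    Order.IsSuccLimit (OrderDual.ofDual (ofLex p).1) ∨ (ofLex p).2 = 0}

/-- Names for the eleven elements of the basis. -/
inductive BasisIndex : Type
  | X | XTwo | XOmega | XOmegaStar | XInt
  | CInt | CStarInt
  | omega1 | omega1BarOmegaStar
  | omega1Star | omega1StarBarOmega

/-- The eleven linear orders
`X, X × 2, X × ω, X × ω*, X × ℤ, C × ℤ, C* × ℤ, ω₁, ω₁ ×̄ ω*, ω₁*, ω₁* ×̄ ω`,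
where all products are lexicographic with the left factor dominant. -/
noncomputable def basisElement (X C : Type u) [LinearOrder X] [LinearOrder C] :
    BasisIndex → LinOrd.{u}
  | .X => LinOrd.of X
  | .XTwo => LinOrd.of (X ×ₗ Fin 2)
  | .XOmega => LinOrd.of (X ×ₗ ℕ)
  | .XOmegaStar => LinOrd.of (X ×ₗ ℕᵒᵈ)
  | .XInt => LinOrd.of (X ×ₗ ℤ)
  | .CInt => LinOrd.of (C ×ₗ ℤ)
  | .CStarInt => LinOrd.of (Cᵒᵈ ×ₗ ℤ)
  | .omega1 => LinOrd.of Omega1.{u}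
  | .omega1BarOmegaStar => LinOrd.of Omega1BarOmegaStar.{u}
  | .omega1Star => LinOrd.of Omega1.{u}ᵒᵈ
  | .omega1StarBarOmega => LinOrd.of Omega1StarBarOmega.{u}

/-- A family of linear orders is a LOTS basis for the class of uncountable linear orders: its
members belong to the class, and every order in the class LOTS-embeds some member. -/
def IsBasis {ι : Type w} (L : ι → LinOrd.{u}) : Prop :=
  (∀ k, Uncountable (L k)) ∧
    ∀ (A : Type u) [LinearOrder A], Uncountable A → ∃ k, Embeds (L k) A

end LOTS

/-!
The whole theorem reduces to one fact: no uncountable linear order `A` continuously embeds into two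
distinct ones of the eleven orders. Indeed each of the eleven orders is itself uncountable, so if it
embedded into another one it would be such an `A`. If `L` is a basis, each of the eleven orders has
some `L k` below it, and distinct orders need distinct `k`.

To prove this fact, every order `A` that embeds into one of the eleven gets a *profile*
(`LOTS.Profile`) that records its coarse order type and the behaviour of its limit points, and the
profiles are shown to exclude one another (`LOTS.not_profile_of_ne`).

* Coarse order type. Suborders of the five orders built from `X` have a monotone countable-to-one
  map to `ℝ`; suborders of `C × ℤ` and of `C* × ℤ` have a square that is a countable union of
  chains; suborders of the orders built from `ω₁` or `ω₁*` have countable initial, respectively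
  final, segments. No two of these properties are compatible with uncountability
  (`LOTS.HasRealProjection.countable_of_Iic`, `LOTS.HasChainSquare.countable_of_Iic`,
  `LOTS.HasChainSquare.countable_of_hasRealProjection` and their order duals). Moreover no
  uncountable order maps strictly monotonically to both `C × ℤ` and `C* × ℤ`, since on a large set
  one obtains an increasing and a decreasing map to `C` whose joint graph lies in a chain.
* Limit points. A continuous strictly monotone map sends points that are limits from the left to
  points that are limits from the left, and likewise on the right (`LOTS.isSuccLimit_map`). For
  example every point of `X × ω` has a successor, so the same is true of each order embedding
  continuously into it. Conversely `LOTS.countable_of_forall_not_isPredLimit` says that an order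
  with a monotone countable-to-one map to `ℝ` all of whose fibres have a greatest element is
  countable if none of its points is a limit from the right. This applies to suborders of `X`,
  `X × 2` and `X × ω*`; it rests on the fact that a monotone real function jumps at only countably
  many points with a successor. A well-order without limits from the left is countable, which
  separates `ω₁` from `ω₁ ×̄ ω*`, in which no point is a limit from the left.
-/

namespace LOTS

open Order Set

variable {A : Type v} [LinearOrder A] {B : Type u} [LinearOrder B]

/-! ### Limit points under continuous embeddings -/

/-- If `f a` had a predecessor `b`, then `Ioi b` would be a neighbourhood of `f a` whose preimage
contains no point below `a`, so `a` would not be a limit from the left. -/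
theorem isSuccLimit_map {f : A → B} (hf : StrictMono f)
    (hc : @Continuous A B (Preorder.topology A) (Preorder.topology B) f) {a : A}
    (ha : IsSuccLimit a) : IsSuccLimit (f a) := by
  let _ := Preorder.topology A
  let _ := Preorder.topology B
  have : OrderTopology A := ⟨rfl⟩
  have : OrderTopology B := ⟨rfl⟩
  obtain ⟨a', ha'⟩ := not_isMin_iff.1 ha.not_isMin
  refine ⟨not_isMin_iff.2 ⟨_, hf ha'⟩, fun b hb => ?_⟩
  have hn : f ⁻¹' Ioi b ∈ nhds a := (isOpen_Ioi.preimage hc).mem_nhds hb.lt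
  obtain ⟨l, hl, hs⟩ := exists_Ioc_subset_of_mem_nhds hn ⟨a', ha'⟩
  exact ha.isSuccPrelimit l ⟨hl, fun c hlc hca => hb.2 (hs ⟨hlc, hca.le⟩) (hf hca)⟩

theorem isPredLimit_map {f : A → B} (hf : StrictMono f)
    (hc : @Continuous A B (Preorder.topology A) (Preorder.topology B) f) {a : A}
    (ha : IsPredLimit a) : IsPredLimit (f a) := by
  let _ := Preorder.topology A
  let _ := Preorder.topology B
  have : OrderTopology A := ⟨rfl⟩
  have : OrderTopology B := ⟨rfl⟩
  obtain ⟨a', ha'⟩ := not_isMax_iff.1 ha.not_isMax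
  refine ⟨not_isMax_iff.2 ⟨_, hf ha'⟩, fun b hb => ?_⟩
  have hn : f ⁻¹' Iio b ∈ nhds a := (isOpen_Iio.preimage hc).mem_nhds hb.lt
  obtain ⟨l, hl, hs⟩ := exists_Ico_subset_of_mem_nhds hn ⟨a', ha'⟩
  exact ha.isPredPrelimit l ⟨hl, fun c hac hcl => hb.2 (hf hac) (hs ⟨hac.le, hcl⟩)⟩

theorem not_isSuccLimit_toLex {F : Type*} [LinearOrder F] {x : B} {m n : F} (h : m ⋖ n) :
    ¬ IsSuccLimit (toLex (x, n)) := fun hl =>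
  hl.isSuccPrelimit (toLex (x, m)) (Prod.Lex.toLex_covBy_toLex_iff.2 (Or.inl ⟨rfl, h⟩))

theorem not_isPredLimit_toLex {F : Type*} [LinearOrder F] {x : B} {m n : F} (h : m ⋖ n) :
    ¬ IsPredLimit (toLex (x, m)) := fun hl =>
  hl.isPredPrelimit (toLex (x, n)) (Prod.Lex.toLex_covBy_toLex_iff.2 (Or.inl ⟨rfl, h⟩))

theorem not_isSuccLimit_omega1BarOmegaStar (p : Omega1BarOmegaStar.{u}) : ¬ IsSuccLimit p := by
  obtain ⟨⟨α, n⟩, hp⟩ := p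
  intro hl
  by_cases hα : IsSuccLimit α
  · -- inside the copy of `ω*` at a limit ordinal, `n + 1` is the predecessor of `n`
    refine hl.isSuccPrelimit
      ⟨toLex (α, OrderDual.toDual (OrderDual.ofDual n + 1)), Or.inl hα⟩ ⟨?_, ?_⟩
    · exact Prod.Lex.toLex_lt_toLex.2 (Or.inr ⟨rfl, Nat.lt_succ_self (OrderDual.ofDual n)⟩)
    · rintro ⟨⟨β, k⟩, hq⟩ h₁ h₂
      rcases Prod.Lex.toLex_lt_toLex.1 h₁ with h₁ | ⟨e₁, h₁⟩ <;>
        rcases Prod.Lex.toLex_lt_toLex.1 h₂ with h₂ | ⟨e₂, h₂⟩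
      · exact lt_asymm h₁ h₂
      · exact h₁.ne e₂.symm
      · exact h₂.ne e₁.symm
      · have h₁ : OrderDual.ofDual k < OrderDual.ofDual n + 1 := h₁
        have h₂ : OrderDual.ofDual n < OrderDual.ofDual k := h₂
        omega
  · have hn : n = OrderDual.toDual 0 := hp.resolve_left hα
    subst hn
    rcases not_isSuccLimit_iff.1 hα with hmin | hs
    · refine hl.not_isMin fun q hq => ?_
      obtain ⟨⟨β, k⟩, hq'⟩ := q
      have hβ : β = α := hmin.eq_of_le (Prod.Lex.monotone_fst _ _ hq)
      subst hβ
      exact Prod.Lex.toLex_le_toLex.2 (Or.inr ⟨rfl, (hq'.resolve_left hα).ge⟩)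
    · obtain ⟨β, hβ⟩ := not_isSuccPrelimit_iff.1 hs
      -- the greatest element of the copy at the predecessor ordinal
      refine hl.isSuccPrelimit ⟨toLex (β, OrderDual.toDual 0), Or.inr rfl⟩
        ⟨Prod.Lex.toLex_lt_toLex.2 (Or.inl hβ.lt), ?_⟩
      rintro ⟨⟨γ, k⟩, hq⟩ h₁ h₂
      rcases Prod.Lex.toLex_lt_toLex.1 h₁ with h₁ | ⟨e₁, h₁⟩
      · rcases Prod.Lex.toLex_lt_toLex.1 h₂ with h₂ | ⟨e₂, h₂⟩
        · exact hβ.2 h₁ h₂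
        · cases e₂
          have hk : k = OrderDual.toDual 0 := hq.resolve_left hα
          exact h₂.ne hk
      · exact Nat.not_lt_zero (OrderDual.ofDual k) h₁

/-- The order `ω₁* ×̄ ω` is the reverse of `ω₁ ×̄ ω*`. -/
def omega1StarBarOmegaIso : Omega1StarBarOmega.{u} ≃o Omega1BarOmegaStar.{u}ᵒᵈ where
  toFun p := OrderDual.toDual
    ⟨toLex (OrderDual.ofDual (ofLex p.1).1, OrderDual.toDual (ofLex p.1).2), p.2⟩
  invFun q := ⟨toLex (OrderDual.toDual (ofLex (OrderDual.ofDual q).1).1,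
    OrderDual.ofDual (ofLex (OrderDual.ofDual q).1).2), (OrderDual.ofDual q).2⟩
  left_inv _ := rfl
  right_inv _ := rfl
  map_rel_iff' := by
    rintro ⟨⟨α, m⟩, hp⟩ ⟨⟨β, n⟩, hq⟩
    refine (Prod.Lex.toLex_le_toLex (α := Omega1.{u}) (β := ℕᵒᵈ)).trans
      (Iff.trans ?_ (Prod.Lex.toLex_le_toLex (α := Omega1.{u}ᵒᵈ) (β := ℕ)).symm)
    exact or_congr Iff.rfl (and_congr eq_comm Iff.rfl)

theorem not_isPredLimit_omega1StarBarOmega (p : Omega1StarBarOmega.{u}) : ¬ IsPredLimit p := by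
  intro hl
  refine not_isSuccLimit_omega1BarOmegaStar (OrderDual.ofDual (omega1StarBarOmegaIso p)) ?_
  rw [← isPredLimit_toDual_iff]
  refine ⟨fun h => hl.not_isMax fun q hq => ?_, fun q hq => ?_⟩
  · exact omega1StarBarOmegaIso.le_iff_le.1 (h (omega1StarBarOmegaIso.le_iff_le.2 hq))
  · refine hl.isPredPrelimit (omega1StarBarOmegaIso.symm q) ?_
    rw [← apply_covBy_apply_iff omega1StarBarOmegaIso, OrderIso.apply_symm_apply]
    exact hq

/-- In a well-order without limit points every proper initial segment is finite. -/
theorem countable_of_wellFoundedLT [WellFoundedLT A] (hA : ∀ a : A, ¬ IsSuccLimit a) :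
    Countable A := by
  have hfin : ∀ a : A, (Iio a).Finite := fun a => by
    induction a using WellFoundedLT.induction with
    | ind a ih =>
      rcases not_isSuccLimit_iff.1 (hA a) with h | h
      · rw [h.Iio_eq]
        exact finite_empty
      · obtain ⟨b, hb⟩ := not_isSuccPrelimit_iff.1 h
        rw [hb.Iio_eq, ← Iio_insert]
        exact (ih b hb.lt).insert b
  -- counting predecessors embeds `A` into `ℕ`
  have hmono : StrictMono fun a : A => (Iio a).ncard := fun a b hab =>
    ncard_lt_ncard (Iio_ssubset_Iio hab) (hfin b)
  exact hmono.injective.countable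

/-! ### Orders with a countable-to-one projection to the reals -/

variable (A) in
/-- There is a monotone countable-to-one map to the real line. -/
def HasRealProjection : Prop :=
  ∃ p : A → ℝ, Monotone p ∧ ∀ x, (p ⁻¹' {x}).Countable

theorem HasRealProjection.dual (h : HasRealProjection A) : HasRealProjection Aᵒᵈ := by
  obtain ⟨p, hp, hc⟩ := h
  refine ⟨fun a => -p (OrderDual.ofDual a), fun a b hab => neg_le_neg (hp hab), fun x => ?_⟩
  refine (hc (-x)).mono fun a ha => ?_
  exact neg_eq_iff_eq_neg.1 ha

/-- Different jumps of `p` at points with a successor span disjoint intervals, and each of these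
contains a rational. -/
theorem countable_setOf_covBy_lt {p : A → ℝ} (hp : Monotone p) :
    {a : A | ∃ b, a ⋖ b ∧ p a < p b}.Countable := by
  have hsub : {a : A | ∃ b, a ⋖ b ∧ p a < p b} ⊆
      ⋃ q : ℚ, {a : A | ∃ b, a ⋖ b ∧ p a < q ∧ q < p b} := by
    rintro a ⟨b, hab, h⟩
    obtain ⟨q, h₁, h₂⟩ := exists_rat_btwn h
    exact mem_iUnion.2 ⟨q, b, hab, h₁, h₂⟩
  refine (countable_iUnion fun q => Subsingleton.countable ?_).mono hsub
  have key : ∀ a b a' : A, a ⋖ b → (q : ℝ) < p b → p a' < q → ¬ a < a' :=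
    fun a b a' hab hb ha' hlt => (hb.trans_le (hp (hab.ge_of_gt hlt))).not_gt ha'
  rintro a ⟨b, hab, ha, hb⟩ a' ⟨b', hab', ha', hb'⟩
  exact le_antisymm (not_lt.1 (key a' b' a hab' hb' ha)) (not_lt.1 (key a b a' hab hb ha'))

/-- If no point is a limit from the right, the greatest point `m` of a fibre of `p` is either the
greatest element of `A` or has a successor at which `p` jumps, so there are only countably many
fibres. -/
theorem countable_of_forall_not_isPredLimit {p : A → ℝ} (hp : Monotone p)
    (hc : ∀ x, (p ⁻¹' {x}).Countable) (hmax : ∀ a, ∃ m, IsGreatest (p ⁻¹' {p a}) m)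
    (hA : ∀ a : A, ¬ IsPredLimit a) : Countable A := by
  have hJ : (p '' ({a : A | ∃ b, a ⋖ b ∧ p a < p b} ∪ {a | IsMax a})).Countable := by
    refine Countable.image (.union (countable_setOf_covBy_lt hp) (Subsingleton.countable ?_)) p
    exact fun a ha b hb => le_antisymm (hb.isTop a) (ha.isTop b)
  refine countable_univ_iff.1 ((hJ.biUnion fun x _ => hc x).mono fun a _ => ?_)
  obtain ⟨m, hm, hub⟩ := hmax a
  have hm : p m = p a := hm
  refine mem_biUnion (x := p a) ⟨m, ?_, hm⟩ rfl
  rcases not_isPredLimit_iff.1 (hA m) with h | h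
  · exact Or.inr h
  · obtain ⟨b, hb⟩ := not_isPredPrelimit_iff.1 h
    refine Or.inl ⟨b, hb, (hp hb.le).lt_of_ne fun he => ?_⟩
    exact (hub (he.symm.trans hm)).not_gt hb.lt

theorem countable_of_forall_not_isSuccLimit {p : A → ℝ} (hp : Monotone p)
    (hc : ∀ x, (p ⁻¹' {x}).Countable) (hmin : ∀ a, ∃ m, IsLeast (p ⁻¹' {p a}) m)
    (hA : ∀ a : A, ¬ IsSuccLimit a) : Countable A := by
  have hfib : ∀ x, (fun a : Aᵒᵈ => -p (OrderDual.ofDual a)) ⁻¹' {x} =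
      OrderDual.ofDual ⁻¹' (p ⁻¹' {-x}) := fun x => by
    ext a
    exact neg_eq_iff_eq_neg
  refine countable_of_forall_not_isPredLimit (A := Aᵒᵈ)
    (p := fun a => -p (OrderDual.ofDual a)) (fun a b hab => neg_le_neg (hp hab))
    (fun x => ?_) (fun a => ?_) (fun a ha => hA (OrderDual.ofDual a) ?_)
  · rw [hfib]
    exact hc _
  · rw [hfib, neg_neg]
    exact hmin (OrderDual.ofDual a)
  · exact isPredLimit_toDual_iff.1 ha

/-- Applied to suborders of `X`: every point other than a limit from both sides is an endpoint or one
of the countably many jumps of `p`, on one side or the other. -/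
theorem countable_of_strictMono_real {p : A → ℝ} (hp : StrictMono p)
    (hA : ∀ a : A, ¬ (IsSuccLimit a ∧ IsPredLimit a)) : Countable A := by
  have hl : {a : A | ¬ IsPredLimit a}.Countable := by
    refine (Countable.union (countable_setOf_covBy_lt hp.monotone)
      (Subsingleton.countable (s := {a | IsMax a}) ?_)).mono fun a ha => ?_
    · exact fun a ha b hb => le_antisymm (hb.isTop a) (ha.isTop b)
    · rcases not_isPredLimit_iff.1 ha with h | h
      · exact Or.inr h
      · obtain ⟨b, hb⟩ := not_isPredPrelimit_iff.1 h
        exact Or.inl ⟨b, hb, hp hb.lt⟩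
  have hr : {a : A | ¬ IsSuccLimit a}.Countable := by
    have hq : Monotone fun a : Aᵒᵈ => -p (OrderDual.ofDual a) :=
      fun a b hab => neg_le_neg (hp.monotone hab)
    refine (Countable.union (s := {a : A | ∃ b, b ⋖ a ∧ p b < p a}) ?_
      (Subsingleton.countable (s := {a | IsMin a}) ?_)).mono fun a ha => ?_
    · refine ((countable_setOf_covBy_lt hq).image OrderDual.ofDual).mono ?_
      rintro a ⟨b, hb, hlt⟩
      exact ⟨OrderDual.toDual a, ⟨OrderDual.toDual b, hb.toDual, neg_lt_neg hlt⟩, rfl⟩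
    · exact fun a ha b hb => le_antisymm (ha.isBot b) (hb.isBot a)
    · rcases not_isSuccLimit_iff.1 ha with h | h
      · exact Or.inr h
      · obtain ⟨b, hb⟩ := not_isSuccPrelimit_iff.1 h
        exact Or.inl ⟨b, hb, hp hb.lt⟩
  refine countable_univ_iff.1 ((hr.union hl).mono fun a _ => ?_)
  exact not_and_or.1 (hA a)

/-- A point at which `p` is not maximal lies in an initial segment `{a | p a < q}` with `q`
rational that is bounded in `A`. -/
theorem HasRealProjection.countable_of_Iic (h : HasRealProjection A)
    (hA : ∀ a : A, (Iic a).Countable) : Countable A := by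
  obtain ⟨p, hp, hc⟩ := h
  have hq : ∀ q : ℚ, {a : A | p a < q ∧ ∃ b, (q : ℝ) < p b}.Countable := fun q => by
    by_cases hb : ∃ b, (q : ℝ) < p b
    · obtain ⟨b, hb⟩ := hb
      exact (hA b).mono fun a ha => (hp.reflect_lt (ha.1.trans hb)).le
    · exact countable_empty.mono fun a ha => hb ha.2
  -- the points at which `p` attains its maximum form a single fibre
  have htop : {a : A | ∀ b, p b ≤ p a}.Countable := by
    rcases eq_empty_or_nonempty {a : A | ∀ b, p b ≤ p a} with he | ⟨a, ha⟩
    · rw [he]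
      exact countable_empty
    · exact (hc (p a)).mono fun b hb => le_antisymm (ha b) (hb a)
  refine countable_univ_iff.1 (((countable_iUnion hq).union htop).mono fun a _ => ?_)
  by_cases ha : ∀ b, p b ≤ p a
  · exact Or.inr ha
  · push Not at ha
    obtain ⟨b, hb⟩ := ha
    obtain ⟨q, h₁, h₂⟩ := exists_rat_btwn hb
    exact Or.inl (mem_iUnion.2 ⟨q, h₁, b, h₂⟩)

/-! ### Orders whose square is a countable union of chains -/

variable (A) in
/-- The square of the order is covered by countably many chains of the product order; this is the
defining property of Countryman lines without the condition on the cardinality. -/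
def HasChainSquare : Prop :=
  ∃ S : ℕ → Set (A × A), (∀ n, IsChain (· ≤ ·) (S n)) ∧ ⋃ n, S n = Set.univ

theorem HasChainSquare.dual (h : HasChainSquare A) : HasChainSquare Aᵒᵈ := by
  obtain ⟨S, hS, hU⟩ := h
  exact ⟨S, fun n x hx y hy hne => (hS n hx hy hne).symm, hU⟩

/-- Splitting each chain of a cover of `B × B` according to the integer coordinates covers
`(B × ℤ) × (B × ℤ)` by countably many chains, and chains pull back to suborders. -/
theorem HasChainSquare.of_strictMono (h : HasChainSquare B) {f : A → B ×ₗ ℤ}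
    (hf : StrictMono f) : HasChainSquare A := by
  obtain ⟨S, hS, hU⟩ := h
  let T : ℕ × ℤ × ℤ → Set (A × A) := fun k =>
    {x | ((ofLex (f x.1)).1, (ofLex (f x.2)).1) ∈ S k.1 ∧
      (ofLex (f x.1)).2 = k.2.1 ∧ (ofLex (f x.2)).2 = k.2.2}
  have hle : ∀ a b : A, (ofLex (f a)).1 ≤ (ofLex (f b)).1 →
      (ofLex (f a)).2 = (ofLex (f b)).2 → a ≤ b := fun a b h₁ h₂ =>
    hf.le_iff_le.1 (Prod.Lex.le_iff'.2 ⟨h₁, fun _ => h₂.le⟩)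
  have hT : ∀ k, IsChain (· ≤ ·) (T k) := by
    rintro k x ⟨hx, hx₁, hx₂⟩ y ⟨hy, hy₁, hy₂⟩ -
    rcases (hS k.1).total hx hy with h | h
    · exact Or.inl ⟨hle _ _ h.1 (hx₁.trans hy₁.symm), hle _ _ h.2 (hx₂.trans hy₂.symm)⟩
    · exact Or.inr ⟨hle _ _ h.1 (hy₁.trans hx₁.symm), hle _ _ h.2 (hy₂.trans hx₂.symm)⟩
  obtain ⟨e⟩ : Nonempty (ℕ ≃ ℕ × ℤ × ℤ) := nonempty_equiv_of_countable
  refine ⟨fun n => T (e n), fun n => hT _, eq_univ_of_forall fun x => ?_⟩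
  obtain ⟨k, hk⟩ := mem_iUnion.1
    (hU ▸ mem_univ ((ofLex (f x.1)).1, (ofLex (f x.2)).1))
  refine mem_iUnion.2 ⟨e.symm (k, (ofLex (f x.1)).2, (ofLex (f x.2)).2), ?_⟩
  rw [Equiv.apply_symm_apply]
  exact ⟨hk, rfl, rfl⟩

/-- Each vertical line `{a} × A` meets some chain of the cover in an uncountable set, and two lines
`a < a'` must do so for the same chain; but then the part on the line at `a` lies below a point on
the line at `a'`. -/
theorem HasChainSquare.countable_of_Iic (h : HasChainSquare A)
    (hA : ∀ a : A, (Iic a).Countable) : Countable A := by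
  obtain ⟨S, hS, hU⟩ := h
  have hcov : ∀ a b, ∃ n, (a, b) ∈ S n := fun a b => mem_iUnion.1 (hU ▸ mem_univ (a, b))
  by_contra hun
  have hn : ∀ a : A, ∃ n, ¬ {b | (a, b) ∈ S n}.Countable := fun a => by
    by_contra! hcon
    refine hun (countable_univ_iff.1 ((countable_iUnion hcon).mono fun b _ => ?_))
    exact mem_iUnion.2 (hcov a b)
  choose n hn using hn
  have hlt : ∀ a a', a < a' → n a ≠ n a' := fun a a' hlt he => by
    have hne : {b | (a', b) ∈ S (n a')}.Nonempty := by
      rw [nonempty_iff_ne_empty]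
      intro h0
      exact hn a' (h0 ▸ countable_empty)
    obtain ⟨b', hb'⟩ := hne
    refine hn a ((hA b').mono fun b hb => ?_)
    have hb : (a, b) ∈ S (n a) := hb
    rw [he] at hb
    rcases (hS _).total hb hb' with h | h
    · exact h.2
    · exact absurd h.1 hlt.not_ge
  have hinj : Function.Injective n := fun a a' he => by
    rcases lt_trichotomy a a' with h | h | h
    · exact absurd he (hlt _ _ h)
    · exact h
    · exact absurd he.symm (hlt _ _ h)
  exact hun hinj.countable

/-- For all but countably many `a`, every chain of the cover meets the vertical line `{a} × A` in a
set on which the projection `p` to `ℝ` is constant, because two points with different projections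
span an interval around some rational, and one chain uses each rational at most once. -/
theorem HasChainSquare.countable_of_hasRealProjection (h : HasChainSquare A)
    (hA : HasRealProjection A) : Countable A := by
  obtain ⟨S, hS, hU⟩ := h
  have hcov : ∀ a b, ∃ n, (a, b) ∈ S n := fun a b => mem_iUnion.1 (hU ▸ mem_univ (a, b))
  obtain ⟨p, hp, hc⟩ := hA
  let bad : ℕ × ℚ → Set A := fun k =>
    {a | ∃ b b', (a, b) ∈ S k.1 ∧ (a, b') ∈ S k.1 ∧ p b < k.2 ∧ k.2 < p b'}
  have hbad : ∀ k, (bad k).Countable := fun k => by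
    have key : ∀ a a' : A, a ∈ bad k → a' ∈ bad k → ¬ a < a' := by
      rintro a a' ⟨-, b, -, hb, -, hq⟩ ⟨b', -, hb', -, hq', -⟩ hlt
      rcases (hS k.1).total hb hb' with h | h
      · exact (hq.trans_le (hp h.2)).not_gt hq'
      · exact absurd h.1 hlt.not_ge
    exact Subsingleton.countable fun a ha a' ha' =>
      le_antisymm (not_lt.1 (key a' a ha' ha)) (not_lt.1 (key a a' ha ha'))
  by_contra hun
  obtain ⟨a, ha⟩ : ∃ a, a ∉ ⋃ k, bad k := by
    by_contra! hcon
    exact hun (countable_univ_iff.1 ((countable_iUnion hbad).mono fun a _ => hcon a))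
  refine hun (countable_univ_iff.1 ((countable_iUnion (t := fun n => {b | (a, b) ∈ S n})
    fun n => ?_).mono fun b _ => mem_iUnion.2 (hcov a b)))
  rcases eq_empty_or_nonempty {b | (a, b) ∈ S n} with he | ⟨b, hb⟩
  · rw [he]
    exact countable_empty
  · have key : ∀ b b', (a, b) ∈ S n → (a, b') ∈ S n → ¬ p b < p b' := fun b b' hb hb' hlt => by
      obtain ⟨q, h₁, h₂⟩ := exists_rat_btwn hlt
      exact ha (mem_iUnion.2 ⟨(n, q), b, b', hb, hb', h₁, h₂⟩)
    exact (hc (p b)).mono fun b' hb' =>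
      le_antisymm (not_lt.1 (key b b' hb hb')) (not_lt.1 (key b' b hb' hb))

/-- An uncountable order cannot map into both `B × ℤ` and `B* × ℤ`: two points with the same integer
coordinates, whose pairs of `B`-coordinates lie in the same chain of the cover, would have
`B`-coordinates that increase in one map and decrease in the other. -/
theorem HasChainSquare.countable_of_strictMono_of_strictMono_dual (h : HasChainSquare B)
    {f : A → B ×ₗ ℤ} (hf : StrictMono f) {g : A → Bᵒᵈ ×ₗ ℤ} (hg : StrictMono g) :
    Countable A := by
  obtain ⟨S, hS, hU⟩ := h
  have hn : ∀ a, ∃ n, ((ofLex (f a)).1, OrderDual.ofDual (ofLex (g a)).1) ∈ S n :=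
    fun a => mem_iUnion.1 (hU ▸ mem_univ _)
  choose n hn using hn
  let colour : A → ℕ × ℤ × ℤ := fun a => (n a, (ofLex (f a)).2, (ofLex (g a)).2)
  have hlt : ∀ a a', a < a' → colour a ≠ colour a' := fun a a' hlt he => by
    simp only [colour, Prod.mk.injEq] at he
    obtain ⟨h₁, h₂, h₃⟩ := he
    have hf' : (ofLex (f a)).1 < (ofLex (f a')).1 :=
      (Prod.Lex.lt_iff.1 (hf hlt)).resolve_right fun h => h.2.ne h₂
    have hg' : (ofLex (g a)).1 < (ofLex (g a')).1 :=
      (Prod.Lex.lt_iff.1 (hg hlt)).resolve_right fun h => h.2.ne h₃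
    have ha := hn a
    rw [h₁] at ha
    rcases (hS _).total ha (hn a') with h | h
    · exact (show _ ≤ _ from h.2).not_gt (OrderDual.ofDual_lt_ofDual.2 hg')
    · exact h.1.not_gt hf'
  have hinj : Function.Injective colour := fun a a' he => by
    rcases lt_trichotomy a a' with h | h | h
    · exact absurd he (hlt _ _ h)
    · exact h
    · exact absurd he.symm (hlt _ _ h)
  exact hinj.countable

/-! ### Profiles of orders below the eleven orders -/

/-- The properties of an order `A` that are extracted from a continuous embedding of `A` into the
given one of the eleven orders: its coarse order type, and which kinds of limit points it has. -/
def Profile (A : Type v) [LinearOrder A] (C : Type u) [LinearOrder C] : BasisIndex → Prop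
  | .X => HasRealProjection A ∧ ¬ ∀ a : A, ¬ (IsSuccLimit a ∧ IsPredLimit a)
  | .XTwo => HasRealProjection A ∧ (∀ a : A, ¬ (IsSuccLimit a ∧ IsPredLimit a)) ∧
      (¬ ∀ a : A, ¬ IsSuccLimit a) ∧ ¬ ∀ a : A, ¬ IsPredLimit a
  | .XOmega => HasRealProjection A ∧ (¬ ∀ a : A, ¬ IsSuccLimit a) ∧ ∀ a : A, ¬ IsPredLimit a
  | .XOmegaStar => HasRealProjection A ∧ (∀ a : A, ¬ IsSuccLimit a) ∧ ¬ ∀ a : A, ¬ IsPredLimit a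
  | .XInt => HasRealProjection A ∧ (∀ a : A, ¬ IsSuccLimit a) ∧ ∀ a : A, ¬ IsPredLimit a
  | .CInt => ∃ f : A → C ×ₗ ℤ, StrictMono f
  | .CStarInt => ∃ f : A → Cᵒᵈ ×ₗ ℤ, StrictMono f
  | .omega1 => (∀ a : A, (Iic a).Countable) ∧ ¬ ∀ a : A, ¬ IsSuccLimit a
  | .omega1BarOmegaStar => (∀ a : A, (Iic a).Countable) ∧ ∀ a : A, ¬ IsSuccLimit a
  | .omega1Star => (∀ a : A, (Ici a).Countable) ∧ ¬ ∀ a : A, ¬ IsPredLimit a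
  | .omega1StarBarOmega => (∀ a : A, (Ici a).Countable) ∧ ∀ a : A, ¬ IsPredLimit a

/-- A strictly monotone map to a lexicographic product `B × F` with `F` countable, followed by the
first projection and an embedding `r` of `B` into `ℝ`, is a projection to `ℝ` whose fibres are
isomorphic to subsets of `F`. -/
theorem fiber_of_strictMono {F : Type*} [LinearOrder F] [Countable F] {r : B → ℝ}
    (hr : StrictMono r) {f : A → B ×ₗ F} (hf : StrictMono f) :
    Monotone (fun a => r (ofLex (f a)).1) ∧
      ∀ x, StrictMonoOn (fun a => (ofLex (f a)).2) ((fun a => r (ofLex (f a)).1) ⁻¹' {x}) ∧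
        ((fun a => r (ofLex (f a)).1) ⁻¹' {x}).Countable := by
  refine ⟨fun a b hab => hr.monotone (Prod.Lex.monotone_fst _ _ (hf.monotone hab)), fun x => ?_⟩
  have hmono :
      StrictMonoOn (fun a => (ofLex (f a)).2) ((fun a => r (ofLex (f a)).1) ⁻¹' {x}) := by
    intro a ha b hb hab
    exact (Prod.Lex.lt_iff'.1 (hf hab)).2 (hr.injective (ha.trans hb.symm))
  exact ⟨hmono, MapsTo.countable_of_injOn (mapsTo_univ _ _) hmono.injOn (to_countable _)⟩

theorem hasRealProjection_of_strictMono {F : Type*} [LinearOrder F] [Countable F] {r : B → ℝ}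
    (hr : StrictMono r) {f : A → B ×ₗ F} (hf : StrictMono f) : HasRealProjection A :=
  ⟨_, (fiber_of_strictMono hr hf).1, fun x => ((fiber_of_strictMono hr hf).2 x).2⟩

theorem countable_of_wellFoundedGT_fiber {F : Type*} [LinearOrder F] [Countable F]
    [WellFoundedGT F] {r : B → ℝ} (hr : StrictMono r) {f : A → B ×ₗ F} (hf : StrictMono f)
    (hA : ∀ a : A, ¬ IsPredLimit a) : Countable A := by
  obtain ⟨hp, hc⟩ := fiber_of_strictMono hr hf
  refine countable_of_forall_not_isPredLimit hp (fun x => (hc x).2) (fun a => ?_) hA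
  obtain ⟨m, hm, hmax⟩ := (InvImage.wf (fun a => (ofLex (f a)).2)
    (wellFounded_gt (α := F))).has_min
      ((fun a => r (ofLex (f a)).1) ⁻¹' {r (ofLex (f a)).1}) ⟨a, rfl⟩
  exact ⟨m, hm, fun b hb => not_lt.1 fun hlt => hmax b hb ((hc _).1 hm hb hlt)⟩

theorem countable_of_wellFoundedLT_fiber {F : Type*} [LinearOrder F] [Countable F]
    [WellFoundedLT F] {r : B → ℝ} (hr : StrictMono r) {f : A → B ×ₗ F} (hf : StrictMono f)
    (hA : ∀ a : A, ¬ IsSuccLimit a) : Countable A := by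
  obtain ⟨hp, hc⟩ := fiber_of_strictMono hr hf
  refine countable_of_forall_not_isSuccLimit hp (fun x => (hc x).2) (fun a => ?_) hA
  obtain ⟨m, hm, hmin⟩ := (InvImage.wf (fun a => (ofLex (f a)).2)
    (wellFounded_lt (α := F))).has_min
      ((fun a => r (ofLex (f a)).1) ⁻¹' {r (ofLex (f a)).1}) ⟨a, rfl⟩
  exact ⟨m, hm, fun b hb => not_lt.1 fun hlt => hmin b hb ((hc _).1 hb hm hlt)⟩

theorem countable_Iic_omega1 (α : Omega1.{u}) : (Iic α).Countable := by
  have h : (Iio α).Countable := by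
    rw [← Cardinal.le_aleph0_iff_set_countable, ← Cardinal.lt_aleph_one_iff]
    simpa using mk_Iio_lt α
  rw [← Iio_insert]
  exact h.insert α

theorem countable_Iic_omega1BarOmegaStar (p : Omega1BarOmegaStar.{u}) : (Iic p).Countable := by
  have h : ((Iic (ofLex p.1).1) ×ˢ (Set.univ : Set ℕᵒᵈ)).Countable :=
    (countable_Iic_omega1 _).prod (to_countable _)
  refine MapsTo.countable_of_injOn (f := fun q => ofLex q.1) (fun q hq => ?_) ?_ h
  · exact ⟨Prod.Lex.monotone_fst _ _ hq, mem_univ _⟩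
  · exact fun q _ q' _ he => Subtype.ext (ofLex.injective he)

theorem countable_Iic_of_strictMono {f : A → B} (hf : StrictMono f)
    (hB : ∀ b : B, (Iic b).Countable) (a : A) : (Iic a).Countable :=
  ((hB (f a)).preimage hf.injective).mono fun _ hb => hf.monotone hb

theorem countable_Ici_of_strictMono {f : A → B} (hf : StrictMono f)
    (hB : ∀ b : B, (Ici b).Countable) (a : A) : (Ici a).Countable :=
  ((hB (f a)).preimage hf.injective).mono fun _ hb => hf.monotone hb

theorem profile_of_embeds {X C : Type u} [LinearOrder X] [LinearOrder C]
    (hX : IsAlephOneDenseRealSet X) [hA : Uncountable A] {i : BasisIndex}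
    (h : Embeds A (basisElement X C i)) : Profile A C i := by
  obtain ⟨S, ⟨φ⟩⟩ := hX.real_set
  have hr : StrictMono fun x => (φ x : ℝ) := fun x y hxy => φ.strictMono hxy
  have hun : ¬ Countable A := not_countable_iff.2 hA
  have hnat : ∀ n : ℕᵒᵈ, OrderDual.toDual (OrderDual.ofDual n + 1) ⋖ n := fun n =>
    (Order.covBy_add_one (OrderDual.ofDual n)).toDual
  have hint : ∀ n : ℤ, n - 1 ⋖ n := fun n => by
    simp
  cases i with
  | X =>
    obtain ⟨f, hf, -⟩ : Embeds A X := h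
    have hrf : StrictMono fun a => (φ (f a) : ℝ) := hr.comp hf
    refine ⟨⟨_, hrf.monotone, fun x => ?_⟩, fun h => hun (countable_of_strictMono_real hrf h)⟩
    exact (subsingleton_singleton.preimage hrf.injective).countable
  | XTwo =>
    obtain ⟨f, hf, hc⟩ : Embeds A (X ×ₗ Fin 2) := h
    refine ⟨hasRealProjection_of_strictMono hr hf, ?_,
      fun h => hun (countable_of_wellFoundedLT_fiber hr hf h),
      fun h => hun (countable_of_wellFoundedGT_fiber hr hf h)⟩
    rintro a ⟨h₁, h₂⟩
    have h₁ := isSuccLimit_map hf hc h₁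
    have h₂ := isPredLimit_map hf hc h₂
    have h01 : (0 : Fin 2) ⋖ 1 := ⟨by decide, by decide⟩
    generalize f a = y at h₁ h₂
    obtain ⟨x, n⟩ := y
    -- `(x, 0)` has the successor `(x, 1)`
    fin_cases n
    · exact not_isPredLimit_toLex h01 h₂
    · exact not_isSuccLimit_toLex h01 h₁
  | XOmega =>
    obtain ⟨f, hf, hc⟩ : Embeds A (X ×ₗ ℕ) := h
    exact ⟨hasRealProjection_of_strictMono hr hf,
      fun h => hun (countable_of_wellFoundedLT_fiber hr hf h), fun a ha =>
      not_isPredLimit_toLex (Order.covBy_add_one _) (isPredLimit_map hf hc ha)⟩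
  | XOmegaStar =>
    obtain ⟨f, hf, hc⟩ : Embeds A (X ×ₗ ℕᵒᵈ) := h
    exact ⟨hasRealProjection_of_strictMono hr hf, fun a ha =>
      not_isSuccLimit_toLex (hnat _) (isSuccLimit_map hf hc ha),
      fun h => hun (countable_of_wellFoundedGT_fiber hr hf h)⟩
  | XInt =>
    obtain ⟨f, hf, hc⟩ : Embeds A (X ×ₗ ℤ) := h
    exact ⟨hasRealProjection_of_strictMono hr hf, fun a ha =>
      not_isSuccLimit_toLex (hint _) (isSuccLimit_map hf hc ha), fun a ha =>
      not_isPredLimit_toLex (Order.covBy_add_one _) (isPredLimit_map hf hc ha)⟩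
  | CInt =>
    obtain ⟨f, hf, -⟩ : Embeds A (C ×ₗ ℤ) := h
    exact ⟨f, hf⟩
  | CStarInt =>
    obtain ⟨f, hf, -⟩ : Embeds A (Cᵒᵈ ×ₗ ℤ) := h
    exact ⟨f, hf⟩
  | omega1 =>
    obtain ⟨f, hf, -⟩ : Embeds A Omega1.{u} := h
    have : WellFoundedLT A := ⟨Subrelation.wf (fun h => hf h) (InvImage.wf f wellFounded_lt)⟩
    exact ⟨countable_Iic_of_strictMono hf countable_Iic_omega1,
      fun h => hun (countable_of_wellFoundedLT h)⟩
  | omega1BarOmegaStar =>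
    obtain ⟨f, hf, hc⟩ : Embeds A Omega1BarOmegaStar.{u} := h
    exact ⟨countable_Iic_of_strictMono hf countable_Iic_omega1BarOmegaStar, fun a ha =>
      not_isSuccLimit_omega1BarOmegaStar _ (isSuccLimit_map hf hc ha)⟩
  | omega1Star =>
    obtain ⟨f, hf, -⟩ : Embeds A Omega1.{u}ᵒᵈ := h
    have : WellFoundedLT Aᵒᵈ := ⟨Subrelation.wf (fun h => hf h)
      (InvImage.wf (fun a : Aᵒᵈ => OrderDual.ofDual (f (OrderDual.ofDual a))) wellFounded_lt)⟩
    refine ⟨countable_Ici_of_strictMono hf countable_Iic_omega1, fun h => hun ?_⟩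
    exact countable_of_wellFoundedLT (A := Aᵒᵈ) fun a ha =>
      h (OrderDual.ofDual a) (isSuccLimit_toDual_iff.1 ha)
  | omega1StarBarOmega =>
    obtain ⟨f, hf, hc⟩ : Embeds A Omega1StarBarOmega.{u} := h
    exact ⟨countable_Ici_of_strictMono (omega1StarBarOmegaIso.strictMono.comp hf)
      countable_Iic_omega1BarOmegaStar, fun a ha =>
      not_isPredLimit_omega1StarBarOmega _ (isPredLimit_map hf hc ha)⟩

theorem not_profile_of_ne {C : Type u} [LinearOrder C] (hC : HasChainSquare C)
    [hA : Uncountable A] {i j : BasisIndex} (hij : i ≠ j) (hi : Profile A C i) :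
    ¬ Profile A C j := by
  have hun : ¬ Countable A := not_countable_iff.2 hA
  have hC₁ : (∃ f : A → C ×ₗ ℤ, StrictMono f) → HasChainSquare A :=
    fun ⟨_, hf⟩ => hC.of_strictMono hf
  have hC₂ : (∃ f : A → Cᵒᵈ ×ₗ ℤ, StrictMono f) → HasChainSquare A :=
    fun ⟨_, hf⟩ => hC.dual.of_strictMono hf
  have hCC : ¬ ((∃ f : A → C ×ₗ ℤ, StrictMono f) ∧ ∃ f : A → Cᵒᵈ ×ₗ ℤ, StrictMono f) :=
    fun ⟨⟨_, hf⟩, ⟨_, hg⟩⟩ => hun (hC.countable_of_strictMono_of_strictMono_dual hf hg)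
  have hCR : ¬ (HasChainSquare A ∧ HasRealProjection A) :=
    fun h => hun (h.1.countable_of_hasRealProjection h.2)
  have hCW : ¬ (HasChainSquare A ∧ ∀ a : A, (Iic a).Countable) :=
    fun h => hun (h.1.countable_of_Iic h.2)
  have hCW' : ¬ (HasChainSquare A ∧ ∀ a : A, (Ici a).Countable) :=
    fun h => hun (h.1.dual.countable_of_Iic h.2)
  have hRW : ¬ (HasRealProjection A ∧ ∀ a : A, (Iic a).Countable) :=
    fun h => hun (h.1.countable_of_Iic h.2)
  have hRW' : ¬ (HasRealProjection A ∧ ∀ a : A, (Ici a).Countable) :=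
    fun h => hun (h.1.dual.countable_of_Iic h.2)
  have hWW : ¬ ((∀ a : A, (Iic a).Countable) ∧ ∀ a : A, (Ici a).Countable) := fun h => by
    obtain ⟨a⟩ : Nonempty A := inferInstance
    refine hun (countable_univ_iff.1 (((h.1 a).union (h.2 a)).mono fun b _ => ?_))
    exact le_total b a
  have hS : (∀ a : A, ¬ IsSuccLimit a) → ∀ a : A, ¬ (IsSuccLimit a ∧ IsPredLimit a) :=
    fun h a ha => h a ha.1
  have hP : (∀ a : A, ¬ IsPredLimit a) → ∀ a : A, ¬ (IsSuccLimit a ∧ IsPredLimit a) :=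
    fun h a ha => h a ha.2
  intro hj
  -- what remains is propositional in the properties that make up the profiles
  cases i <;> cases j <;> first | exact hij rfl | (simp only [Profile] at hi hj; grind only)

/-! ### Uncountability and enumeration of the eleven orders -/

theorem uncountable_of_mk_eq {L : Type u} (h : Cardinal.mk L = Cardinal.aleph 1) :
    Uncountable L :=
  Cardinal.aleph0_lt_mk_iff.1 (h ▸ Cardinal.aleph0_lt_aleph_one)

theorem uncountable_omega1 : Uncountable Omega1.{u} :=
  uncountable_of_mk_eq (by simp)

theorem uncountable_toLex {B : Type u} {F : Type*} (hB : Uncountable B) (c : F) :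
    Uncountable (B ×ₗ F) :=
  Function.Injective.uncountable (f := fun x : B => toLex (x, c)) fun _ _ h =>
    congrArg Prod.fst (toLex.injective h)

theorem uncountable_omega1BarOmegaStar : Uncountable Omega1BarOmegaStar.{u} :=
  have := uncountable_omega1.{u}
  Function.Injective.uncountable
    (f := fun α : Omega1.{u} => (⟨toLex (α, OrderDual.toDual 0), Or.inr rfl⟩ :
      Omega1BarOmegaStar.{u})) fun _ _ h =>
    congrArg Prod.fst (toLex.injective (congrArg Subtype.val h))

theorem uncountable_basisElement {X C : Type u} [LinearOrder X] [LinearOrder C]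
    (hX : Uncountable X) (hC : Uncountable C) (i : BasisIndex) :
    Uncountable (basisElement X C i) := by
  cases i with
  | X => exact hX
  | XTwo => exact uncountable_toLex hX (0 : Fin 2)
  | XOmega => exact uncountable_toLex hX (0 : ℕ)
  | XOmegaStar => exact uncountable_toLex hX (OrderDual.toDual (0 : ℕ))
  | XInt => exact uncountable_toLex hX (0 : ℤ)
  | CInt => exact uncountable_toLex hC (0 : ℤ)
  | CStarInt => exact uncountable_toLex (B := Cᵒᵈ) hC (0 : ℤ)
  | omega1 => exact uncountable_omega1
  | omega1BarOmegaStar => exact uncountable_omega1BarOmegaStar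
  | omega1Star => exact uncountable_omega1
  | omega1StarBarOmega =>
    have : Uncountable Omega1BarOmegaStar.{u}ᵒᵈ := uncountable_omega1BarOmegaStar
    exact omega1StarBarOmegaIso.symm.injective.uncountable

theorem Embeds.refl (A : Type u) [LinearOrder A] : Embeds A A :=
  ⟨id, strictMono_id, @continuous_id A (Preorder.topology A)⟩

/-- Enumeration of the names of the eleven orders by `Fin 11`. -/
def basisIndexOfFin : Fin 11 → BasisIndex :=
  ![.X, .XTwo, .XOmega, .XOmegaStar, .XInt, .CInt, .CStarInt, .omega1, .omega1BarOmegaStar,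
    .omega1Star, .omega1StarBarOmega]

theorem basisIndexOfFin_injective : Function.Injective basisIndexOfFin := by
  intro a b h
  fin_cases a <;> fin_cases b <;> first | rfl | (exact absurd h (by simp [basisIndexOfFin]))

end LOTS

theorem mainTheorem2 (X C : Type u) [LinearOrder X] [LinearOrder C]
    (hX : LOTS.IsAlephOneDenseRealSet X)
    (hC : LOTS.IsAlephOneDense C) (hC_countryman : LOTS.IsCountryman C)
    (hC_nonstationary : LOTS.IsNonstationary C) :
    -- no element continuously embeds into another one
    (∀ i j : LOTS.BasisIndex, i ≠ j →
      ¬ LOTS.Embeds (LOTS.basisElement X C i) (LOTS.basisElement X C j)) ∧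
    -- no uncountable linear order continuously embeds into two distinct elements
    (∀ i j : LOTS.BasisIndex, i ≠ j → ∀ (A : Type v) [LinearOrder A], Uncountable A →
      ¬ (LOTS.Embeds A (LOTS.basisElement X C i) ∧ LOTS.Embeds A (LOTS.basisElement X C j))) ∧
    -- every basis needs a member below each of the eleven elements
    (∀ (ι : Type w) (L : ι → LinOrd.{u}), LOTS.IsBasis L →
      ∀ i : LOTS.BasisIndex, ∃ k, LOTS.Embeds (L k) (LOTS.basisElement X C i)) ∧
    -- no proper subfamily of the eleven elements is a basis
    (∀ S : Set LOTS.BasisIndex,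
      LOTS.IsBasis (fun i : S => LOTS.basisElement X C i) → S = Set.univ) ∧
    -- every basis has at least eleven elements
    (∀ (ι : Type w) (L : ι → LinOrd.{u}), LOTS.IsBasis L → (11 : Cardinal.{w}) ≤ Cardinal.mk ι) := by
  have hC' : LOTS.HasChainSquare C := hC_countryman.chains
  have hXu : Uncountable X := LOTS.uncountable_of_mk_eq hX.dense.card_eq
  have hCu : Uncountable C := LOTS.uncountable_of_mk_eq hC.card_eq
  have hunc := LOTS.uncountable_basisElement hXu hCu
  have hsep : ∀ i j : LOTS.BasisIndex, i ≠ j →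
      ¬ LOTS.Embeds (LOTS.basisElement X C i) (LOTS.basisElement X C j) := fun i j hij h =>
    have := hunc i
    LOTS.not_profile_of_ne hC' hij (LOTS.profile_of_embeds hX (LOTS.Embeds.refl _))
      (LOTS.profile_of_embeds hX h)
  refine ⟨hsep, fun i j hij A _ hA h => ?_, fun ι L hL i => ?_, fun S hS => ?_, fun ι L hL => ?_⟩
  · exact LOTS.not_profile_of_ne hC' hij (LOTS.profile_of_embeds hX h.1)
      (LOTS.profile_of_embeds hX h.2)
  · exact hL.2 _ (hunc i)
  · refine Set.eq_univ_of_forall fun i => ?_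
    obtain ⟨k, hk⟩ := hS.2 _ (hunc i)
    by_contra hi
    exact hsep k i (fun he => hi (he ▸ k.2)) hk
  · choose k hk using fun i => hL.2 _ (hunc i)
    -- a member of the basis is below at most one of the eleven orders
    have hinj : Function.Injective k := fun i j he => by
      by_contra hij
      have := hL.1 (k i)
      exact LOTS.not_profile_of_ne hC' hij (LOTS.profile_of_embeds hX (hk i))
        (LOTS.profile_of_embeds hX (he ▸ hk j))
    have hle := Cardinal.mk_le_of_injective
      ((hinj.comp LOTS.basisIndexOfFin_injective).comp
        (ULift.down_injective (α := Fin 11)))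
    simpa using hle
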